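/- Let $K$ be a zero-dimensional compact Hausdorff space (i.e. the clopen subsets of $K$ form a base of its topology), and let $\mathrm{clop}(K)$ be the Boolean algebra of clopen subsets of $K$. Let $\mathfrak A$ and $\mathfrak B$ be Boolean algebras that are not atomic, i.e. each of them has a nonzero element with no atom below it (for instance, $\mathfrak A$ and $\mathfrak B$ may be nontrivial and atomless). Let $\mathfrak A\otimes\mathfrak B$ be their free product (the coproduct in the category of Boolean algebras), that is, the algebra of subsets of $\mathrm{Ult}(\mathfrak A)\times\mathrm{Ult}(\mathfrak B)$ generated by the rectangles $\{x: a\in x\}\times\{y: b\in y\}$ with $a\in\mathfrak A$, $b\in\mathfrak B$, where $\mathrm{Ult}$ denotes the set of ultrafilters. If there is a surjective Boolean homomorphism from $\mathrm{clop}(K)$ onto $\mathfrak A\otimes\mathfrak B$, then the Banach space $\mathcal C(K)$ of continuous real-valued functions on $K$ with the supremum norm contains a complemented copy of $\mathcal C([0,1])$: there is a linear subspace of $\mathcal C(K)$ which is the range of a bounded linear projection on $\mathcal C(K)$ and which is linearly homeomorphic to $\mathcal C([0,1])$. -/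

import Mathlib

/-- The set underlying the Stone space of a Boolean algebra `A`: its ultrafilters, represented by
their characteristic functions, that is, by the Boolean homomorphisms from `A` to the two-element
algebra (between Boolean algebras, bounded lattice homomorphisms are the same as Boolean
homomorphisms). -/
abbrev StonePoint (A : Type*) [BooleanAlgebra A] : Type _ :=
  BoundedLatticeHom A Bool

/-- The rectangle `[a] × [b]` in the product of the Stone spaces of `A` and `B`: the pairs of
ultrafilters `(x, y)` with `a ∈ x` and `b ∈ y`. -/
def stoneRectangle {A B : Type*} [BooleanAlgebra A] [BooleanAlgebra B] (a : A) (b : B) :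
    Set (StonePoint A × StonePoint B) :=
  {p | p.1 a = true ∧ p.2 b = true}

/-- The free product `A ⊗ B` (the coproduct in the category of Boolean algebras), in its standard
concrete form: the Boolean algebra of subsets of the product of the Stone spaces of `A` and `B`
that is generated by the rectangles `[a] × [b]`, `a ∈ A`, `b ∈ B`. The canonical copies of `A` and
`B` in it are `a ↦ [a] × [⊤]` and `b ↦ [⊤] × [b]`. -/
def freeProduct (A B : Type*) [BooleanAlgebra A] [BooleanAlgebra B] :
    BooleanSubalgebra (Set (StonePoint A × StonePoint B)) :=
  BooleanSubalgebra.closure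
    (Set.range fun q : A × B => stoneRectangle q.1 q.2)

/-- The Banach space `X` contains a complemented copy of the Banach space `Y`: some subspace of `X`
that is the range of a bounded projection on `X` is linearly homeomorphic to `Y`. -/
def ContainsComplementedCopy (X Y : Type*) [NormedAddCommGroup X] [NormedSpace ℝ X]
    [NormedAddCommGroup Y] [NormedSpace ℝ Y] : Prop :=
  ∃ Z : Submodule ℝ X, Z.ClosedComplemented ∧ Nonempty (Y ≃L[ℝ] Z)

/-! Stone duality embeds `X × Y`, the product of the two Stone spaces, in `K`. A nonatomic algebra
can be split repeatedly below a nonzero element with no atom under it, so `X` and `Y` map onto the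
Cantor space, hence onto the circle `G`, by maps `f` and `g`. Put `h (x, y) = f x + g y`.

The crux is a bounded left inverse `T` of `ψ ↦ ψ ∘ h`. Lift Haar measure to positive functionals
`M`, `N` along `f`, `g`, and let `T u` be the Haar density of the image under `h` of `u · (M ⊗ N)`.
For `u = v ⊗ w` this image is the convolution of two measures with bounded densities, so its density
is continuous (`exists_isDensity_tensor`). Since the density is bounded by `‖u‖`, this extends to
all `u` (`exists_density_operator`).

Finally, `C([0,1])` is complemented in `C(G)` through the fold of the circle, and the folded map `X
× Y → [0,1]` extends to `K` by Tietze. -/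

open Topology MeasureTheory

/-- The Stone topology on the ultrafilters of a Boolean algebra: pointwise convergence. -/
noncomputable instance StonePoint.instTopologicalSpace {A : Type*} [BooleanAlgebra A] :
    TopologicalSpace (BoundedLatticeHom A Bool) :=
  TopologicalSpace.induced (fun x a => x a) Pi.topologicalSpace

/-! ### Stone spaces: compactness and maps onto the Cantor space. -/

namespace StonePoint

section

variable {A : Type*} [BooleanAlgebra A]

theorem isEmbedding_coe : IsEmbedding (fun (x : StonePoint A) (a : A) => x a) :=
  ⟨⟨rfl⟩, fun _ _ h => DFunLike.coe_injective h⟩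

theorem continuous_apply (a : A) : Continuous fun x : StonePoint A => x a :=
  (_root_.continuous_apply a).comp isEmbedding_coe.continuous

theorem eventually_apply_eq (x : StonePoint A) (a : A) : ∀ᶠ y in 𝓝 x, y a = x a :=
  (continuous_apply a).continuousAt.eventually
    ((isOpen_discrete {x a}).mem_nhds (Set.mem_singleton _))

/-- Each homomorphism identity involves finitely many coordinates, hence is a closed condition. This
gives compactness. -/
theorem isClosed_range_coe :
    IsClosed (Set.range fun (x : StonePoint A) (a : A) => x a) := by
  have h : (Set.range fun (x : StonePoint A) (a : A) => x a) =
      {f : A → Bool | f ⊤ = ⊤} ∩ {f | f ⊥ = ⊥} ∩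
        ((⋂ a, ⋂ b, {f | f (a ⊔ b) = f a ⊔ f b}) ∩ ⋂ a, ⋂ b, {f | f (a ⊓ b) = f a ⊓ f b}) := by
    ext f
    simp only [Set.mem_range, Set.mem_inter_iff, Set.mem_ofPred_eq, Set.mem_iInter]
    constructor
    · rintro ⟨x, rfl⟩
      exact ⟨⟨map_top x, map_bot x⟩, map_sup x, map_inf x⟩
    · rintro ⟨⟨h₁, h₂⟩, h₃, h₄⟩
      exact ⟨⟨⟨⟨f, h₃⟩, h₄⟩, h₁, h₂⟩, rfl⟩
  rw [h]
  have hop (g : Bool × Bool → Bool) (a b : A) : Continuous fun f : A → Bool => g (f a, f b) :=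
    (continuous_of_discreteTopology (f := g)).comp
      ((_root_.continuous_apply a).prodMk (_root_.continuous_apply b))
  refine ((isClosed_eq (by fun_prop) continuous_const).inter
    (isClosed_eq (by fun_prop) continuous_const)).inter
      ((isClosed_iInter fun a => isClosed_iInter fun b => isClosed_eq (by fun_prop) ?_).inter
        (isClosed_iInter fun a => isClosed_iInter fun b => isClosed_eq (by fun_prop) ?_))
  · exact hop (fun p => p.1 ⊔ p.2) a b
  · exact hop (fun p => p.1 ⊓ p.2) a b

instance : CompactSpace (BoundedLatticeHom A Bool) :=
  IsClosedEmbedding.compactSpace (Y := A → Bool) ⟨isEmbedding_coe, isClosed_range_coe⟩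

instance : T2Space (BoundedLatticeHom A Bool) :=
  (isEmbedding_coe (A := A)).t2Space

theorem apply_compl (x : StonePoint A) (a : A) : x aᶜ = !(x a) := by
  rw [map_compl' x a]; rfl

/-- A decreasing sequence of nonzero elements is contained in an ultrafilter. -/
theorem exists_forall_apply_eq_true {b : ℕ → A} (hb : Antitone b) (hne : ∀ n, b n ≠ ⊥) :
    ∃ x : StonePoint A, ∀ n, x (b n) = true := by
  have hF : Order.IsPFilter {c : A | ∃ n, b n ≤ c} := by
    refine Order.IsPFilter.of_def ⟨b 0, 0, le_rfl⟩ ?_ ?_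
    · rintro c ⟨m, hm⟩ d ⟨n, hn⟩
      exact ⟨b (max m n), ⟨_, le_rfl⟩, (hb (le_max_left _ _)).trans hm,
        (hb (le_max_right _ _)).trans hn⟩
    · rintro c d hcd ⟨n, hn⟩
      exact ⟨n, hn.trans hcd⟩
  have hdis : Disjoint (hF.toPFilter : Set A) ((⊥ : Order.Ideal A) : Set A) := by
    rw [Set.disjoint_left]
    rintro c ⟨n, hn⟩ hc
    have hc' : c = ⊥ := le_bot_iff.1 (Order.Ideal.mem_principal.1 hc)
    exact hne n (le_bot_iff.1 (hc' ▸ hn))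
  obtain ⟨J, hJ, -, hJF⟩ := DistribLattice.prime_ideal_of_disjoint_filter_ideal hdis
  classical
  have hmem : ∀ n, b n ∉ J := fun n h => Set.disjoint_left.1 hJF ⟨n, le_rfl⟩ h
  have hproper : (⊤ : A) ∉ J := hJ.top_notMem
  refine ⟨⟨⟨⟨fun c => decide (c ∉ J), fun c d => ?_⟩, fun c d => ?_⟩, ?_, ?_⟩, fun n => ?_⟩
  · rw [Bool.eq_iff_iff]
    simp only [decide_eq_true_eq, Bool.max_eq_or, Bool.or_eq_true, Order.Ideal.sup_mem_iff]
    tauto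
  · have : c ⊓ d ∈ J ↔ c ∈ J ∨ d ∈ J :=
      ⟨fun h => hJ.mem_or_mem h, fun h => h.elim (J.lower inf_le_left) (J.lower inf_le_right)⟩
    rw [Bool.eq_iff_iff]
    simp only [decide_eq_true_eq, Bool.min_eq_and, Bool.and_eq_true, this]
    tauto
  · exact decide_eq_true hproper
  · exact decide_eq_false (not_not.2 J.bot_mem)
  · exact decide_eq_true (hmem n)

/-- The decreasing sequence obtained by passing, at each step, from `p` to `s p` or to `p \ s p`
according to the next bit. -/
def branch (s : A → A) (a : A) (ε : ℕ → Bool) : ℕ → A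
  | 0 => a
  | n + 1 => if ε n then s (branch s a ε n) else branch s a ε n \ s (branch s a ε n)

/-- The branch that an ultrafilter `x` follows. -/
noncomputable def path (s : A → A) (a : A) (x : StonePoint A) : ℕ → A
  | 0 => a
  | n + 1 => if x (s (path s a x n)) then s (path s a x n)
      else path s a x n \ s (path s a x n)

theorem isLocallyConstant_path (s : A → A) (a : A) (n : ℕ) :
    IsLocallyConstant fun x : StonePoint A => path s a x n := by
  induction n with
  | zero => exact IsLocallyConstant.const a
  | succ n ih =>
    rw [IsLocallyConstant.iff_eventually_eq] at ih ⊢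
    intro x
    filter_upwards [ih x, eventually_apply_eq x (s (path s a x n))] with y h₁ h₂
    simp only [path, h₁, h₂]

theorem continuous_bits (s : A → A) (a : A) :
    Continuous fun (x : StonePoint A) (n : ℕ) => x (s (path s a x n)) := by
  refine continuous_pi fun n => IsLocallyConstant.continuous ?_
  have h := isLocallyConstant_path s a n
  rw [IsLocallyConstant.iff_eventually_eq] at h ⊢
  intro x
  filter_upwards [h x, eventually_apply_eq x (s (path s a x n))] with y h₁ h₂
  rw [h₁, h₂]

/-- Prescribed bits determine a decreasing branch of nonzero elements; any ultrafilter containing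
this branch must follow it and so reads off these bits. -/
theorem surjective_bits {s : A → A} {a : A} (ha : a ≠ ⊥)
    (hs : ∀ b ≤ a, b ≠ ⊥ → s b ≠ ⊥ ∧ s b < b) :
    Function.Surjective fun (x : StonePoint A) (n : ℕ) => x (s (path s a x n)) := by
  intro ε
  have hbr : ∀ n, branch s a ε n ≤ a ∧ branch s a ε n ≠ ⊥ := by
    intro n
    induction n with
    | zero => exact ⟨le_rfl, ha⟩
    | succ n ih =>
      obtain ⟨h₁, h₂⟩ := hs _ ih.1 ih.2
      unfold branch
      split_ifs
      · exact ⟨h₂.le.trans ih.1, h₁⟩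
      · exact ⟨sdiff_le.trans ih.1, fun h => h₂.not_ge (sdiff_eq_bot_iff.1 h)⟩
  have hanti : Antitone (branch s a ε) := by
    refine antitone_nat_of_succ_le fun n => ?_
    conv_lhs => unfold branch
    split_ifs
    · exact (hs _ (hbr n).1 (hbr n).2).2.le
    · exact sdiff_le
  obtain ⟨x, hx⟩ := exists_forall_apply_eq_true hanti fun n => (hbr n).2
  have hbit : ∀ n, x (s (branch s a ε n)) = ε n := by
    intro n
    have h := hx (n + 1)
    unfold branch at h
    split_ifs at h with hε
    · rw [h, hε]
    · rw [sdiff_eq, map_inf, apply_compl, Bool.min_eq_and, Bool.and_eq_true] at h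
      simpa [hε] using h.2
  have hpath : ∀ n, path s a x n = branch s a ε n := by
    intro n
    induction n with
    | zero => rfl
    | succ n ih => simp only [path, branch, ih, hbit]
  exact ⟨x, funext fun n => by simp only [hpath, hbit]⟩

/-- The Stone space of a Boolean algebra that is not atomic maps onto the Cantor space. -/
theorem exists_continuous_surjective_nat_bool (hA : ¬ IsAtomic A) :
    ∃ f : C(StonePoint A, ℕ → Bool), Function.Surjective f := by
  have h : ∃ a : A, a ≠ ⊥ ∧ ∀ b ≤ a, ¬ IsAtom b := by
    by_contra! h
    exact hA ⟨fun b => or_iff_not_imp_left.2 fun hb =>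
      let ⟨c, h₁, h₂⟩ := h b hb; ⟨c, h₂, h₁⟩⟩
  obtain ⟨a, ha, hat⟩ := h
  have hsplit : ∀ b : A, ∃ c, b ≤ a → b ≠ ⊥ → c ≠ ⊥ ∧ c < b := by
    intro b
    by_cases hb : b ≤ a ∧ b ≠ ⊥
    · have h := hat b hb.1
      simp only [IsAtom, not_and, not_forall] at h
      obtain ⟨c, hc, hc'⟩ := h hb.2
      exact ⟨c, fun _ _ => ⟨hc', hc⟩⟩
    -- A default value: branches never leave the nonzero elements below `a`.
    · exact ⟨⊥, fun h₁ h₂ => absurd ⟨h₁, h₂⟩ hb⟩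
  choose s hs using hsplit
  exact ⟨⟨_, continuous_bits s a⟩, surjective_bits ha hs⟩

end

/-! ### Stone duality for the free product. -/

section FreeProduct

variable {A B : Type*} [BooleanAlgebra A] [BooleanAlgebra B]

theorem isClopen_stoneRectangle (a : A) (b : B) : IsClopen (stoneRectangle a b) := by
  have h : Continuous fun p : StonePoint A × StonePoint B => (p.1 a, p.2 b) :=
    ((continuous_apply a).comp continuous_fst).prodMk ((continuous_apply b).comp continuous_snd)
  have h' : stoneRectangle a b = (fun p : StonePoint A × StonePoint B => (p.1 a, p.2 b)) ⁻¹'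
      {(true, true)} := by
    ext p
    simp [stoneRectangle]
  exact h' ▸ (isClopen_discrete _).preimage h

theorem isClopen_of_mem_freeProduct {s : Set (StonePoint A × StonePoint B)}
    (hs : s ∈ freeProduct A B) : IsClopen s := by
  induction hs using BooleanSubalgebra.closure_bot_sup_induction with
  | mem x hx =>
    obtain ⟨q, rfl⟩ := hx
    exact isClopen_stoneRectangle q.1 q.2
  | bot => exact isClopen_empty
  | sup x _ y _ hx hy => exact hx.union hy
  | compl x _ hx => exact hx.compl

theorem exists_mem_freeProduct_of_ne {p q : StonePoint A × StonePoint B} (hpq : p ≠ q) :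
    ∃ s : freeProduct A B, ¬ (p ∈ (s : Set (StonePoint A × StonePoint B)) ↔
      q ∈ (s : Set (StonePoint A × StonePoint B))) := by
  by_contra! h
  have hrect : ∀ a b, (p ∈ stoneRectangle a b ↔ q ∈ stoneRectangle a b) := fun a b =>
    h ⟨stoneRectangle a b, BooleanSubalgebra.subset_closure ⟨(a, b), rfl⟩⟩
  refine hpq (Prod.ext ?_ ?_)
  · refine DFunLike.ext _ _ fun a => Bool.eq_iff_iff.2 ?_
    simpa [stoneRectangle] using hrect a ⊤
  · refine DFunLike.ext _ _ fun b => Bool.eq_iff_iff.2 ?_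
    simpa [stoneRectangle] using hrect ⊤ b

/-- Stone duality: a surjection of the clopen algebra of `K` onto the free product embeds the
product of the Stone spaces in `K`. -/
theorem exists_isClosedEmbedding {K : Type*} [TopologicalSpace K] [CompactSpace K] [T2Space K]
    (hK : TopologicalSpace.IsTopologicalBasis {s : Set K | IsClopen s})
    (φ : BoundedLatticeHom (TopologicalSpace.Clopens K) (freeProduct A B))
    (hφ : Function.Surjective φ) :
    ∃ j : StonePoint A × StonePoint B → K, IsClosedEmbedding j := by
  have hcoe : ∀ (c : TopologicalSpace.Clopens K),
      (φ cᶜ : Set (StonePoint A × StonePoint B)) =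
        (φ c : Set (StonePoint A × StonePoint B))ᶜ := fun c => by
    rw [map_compl' φ c]; rfl
  -- The clopen sets `c` with `p ∈ φ c` have the finite intersection property, because `φ` preserves
  -- meets and `⊥`; compactness gives `k`.
  have hpt : ∀ p : StonePoint A × StonePoint B, ∃ k : K, ∀ c : TopologicalSpace.Clopens K,
      p ∈ (φ c : Set (StonePoint A × StonePoint B)) → k ∈ c := by
    intro p
    have hne : (⋂ c : {c // p ∈ (φ c : Set (StonePoint A × StonePoint B))},
        ((c : TopologicalSpace.Clopens K) : Set K)).Nonempty := by
      refine CompactSpace.iInter_nonempty (fun c => c.1.isClopen.isClosed) fun s => ?_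
      have key : ∃ d : TopologicalSpace.Clopens K,
          p ∈ (φ d : Set (StonePoint A × StonePoint B)) ∧
            (d : Set K) ⊆ ⋂ c ∈ s, ((c : TopologicalSpace.Clopens K) : Set K) := by
        classical
        induction s using Finset.induction_on with
        | empty => exact ⟨⊤, by rw [map_top]; trivial, by simp⟩
        | insert c s _ ih =>
          obtain ⟨d, hd, hds⟩ := ih
          refine ⟨c.1 ⊓ d, ?_, ?_⟩
          · rw [map_inf]; exact ⟨c.2, hd⟩
          · rw [Finset.set_biInter_insert]
            exact Set.inter_subset_inter_right _ hds
      obtain ⟨d, hd, hds⟩ := key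
      have hdne : (d : Set K).Nonempty := by
        rw [Set.nonempty_iff_ne_empty]
        intro h
        have : d = ⊥ := TopologicalSpace.Clopens.ext h
        rw [this, map_bot] at hd
        exact hd
      exact hdne.mono hds
    obtain ⟨k, hk⟩ := hne
    exact ⟨k, fun c hc => Set.mem_iInter.1 hk ⟨c, hc⟩⟩
  choose j hj using hpt
  have hj' : ∀ p c, j p ∈ c ↔ p ∈ (φ c : Set (StonePoint A × StonePoint B)) := by
    refine fun p c => ⟨fun h => ?_, hj p c⟩
    by_contra hp
    exact hj p cᶜ (by rw [hcoe]; exact hp) h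
  refine ⟨j, Continuous.isClosedEmbedding ?_ ?_⟩
  · refine hK.continuous_iff.2 fun s hs => ?_
    have : j ⁻¹' s = (φ ⟨s, hs⟩ : Set (StonePoint A × StonePoint B)) :=
      Set.ext fun p => hj' p ⟨s, hs⟩
    rw [this]
    exact (isClopen_of_mem_freeProduct (φ ⟨s, hs⟩).2).isOpen
  · intro p q hpq
    by_contra hne
    obtain ⟨s, hs⟩ := exists_mem_freeProduct_of_ne hne
    obtain ⟨c, rfl⟩ := hφ s
    exact hs (by rw [← hj', ← hj', hpq])

end FreeProduct

end StonePoint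

namespace AveragingOperator

/-! ### Positive functionals and their lifts. -/

section PositiveFunctional

variable {X : Type*} [TopologicalSpace X]

theorem abs_le_of_positive {M : C(X, ℝ) →ₗ[ℝ] ℝ} (hM : ∀ u, 0 ≤ u → 0 ≤ M u) {u v : C(X, ℝ)}
    (h : ∀ x, |u x| ≤ v x) : |M u| ≤ M v := by
  have h₁ := hM (v - u) fun x => sub_nonneg.2 ((le_abs_self _).trans (h x))
  have h₂ := hM (v + u) fun x => by
    have := (neg_abs_le (u x)).trans' (neg_le_neg (h x))
    simpa using by linarith
  rw [map_sub] at h₁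
  rw [map_add] at h₂
  exact abs_le.2 ⟨by linarith, by linarith⟩

theorem abs_mul_le_of_positive [CompactSpace X] {M : C(X, ℝ) →ₗ[ℝ] ℝ}
    (hM : ∀ u, 0 ≤ u → 0 ≤ M u) {u v w : C(X, ℝ)} (h : ∀ x, |v x| ≤ w x) :
    |M (u * v)| ≤ ‖u‖ * M w := by
  have : M (‖u‖ • w) = ‖u‖ * M w := by rw [map_smul, smul_eq_mul]
  rw [← this]
  refine abs_le_of_positive hM fun x => ?_
  simp only [ContinuousMap.mul_apply, abs_mul, ContinuousMap.smul_apply, smul_eq_mul]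
  exact mul_le_mul (u.norm_coe_le_norm x) (h x) (abs_nonneg _) (norm_nonneg _)

/-- A positive normalized functional is bounded. -/
noncomputable def positiveCLM [CompactSpace X] (M : C(X, ℝ) →ₗ[ℝ] ℝ)
    (hM : ∀ u, 0 ≤ u → 0 ≤ M u) (hM₁ : M 1 = 1) : C(X, ℝ) →L[ℝ] ℝ :=
  M.mkContinuous 1 fun u => by
    have := abs_mul_le_of_positive hM (u := u) (v := 1) (w := 1) fun x => by simp
    rw [mul_one, hM₁, mul_one] at this
    simpa using this

/-- A positive normalized functional on `C(G, ℝ)` lifts along a continuous surjection onto `G`. -/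
theorem exists_positive_lift [CompactSpace X] {G : Type*} [TopologicalSpace G]
    {I : C(G, ℝ) →L[ℝ] ℝ} (hI : ∀ φ, 0 ≤ φ → 0 ≤ I φ) (hI₁ : I 1 = 1) (f : C(X, G))
    (hf : Function.Surjective f) :
    ∃ M : C(X, ℝ) →L[ℝ] ℝ, (∀ u, 0 ≤ u → 0 ≤ M u) ∧
      ∀ φ : C(G, ℝ), M (φ.comp f) = I φ := by
  let C : C(G, ℝ) →ₗ[ℝ] C(X, ℝ) :=
    { toFun := fun φ => φ.comp f, map_add' := fun _ _ => rfl, map_smul' := fun _ _ => rfl }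
  have hC : Function.Injective C := fun φ ψ h => ContinuousMap.ext fun t => by
    obtain ⟨x, rfl⟩ := hf t
    exact DFunLike.congr_fun h x
  let e := LinearEquiv.ofInjective C hC
  have he : ∀ φ, e.symm ⟨C φ, φ, rfl⟩ = φ := fun φ => e.symm_apply_apply φ
  obtain ⟨M, hM, hpos⟩ := riesz_extension (PointedCone.positive ℝ C(X, ℝ))
    ⟨C.range, I.toLinearMap ∘ₗ e.symm.toLinearMap⟩
    (by
      rintro ⟨_, φ, rfl⟩ h
      have h' : (0 : C(X, ℝ)) ≤ C φ := h
      change 0 ≤ I (e.symm ⟨C φ, φ, rfl⟩)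
      rw [he]
      refine hI _ fun t => ?_
      obtain ⟨x, rfl⟩ := hf t
      exact h' x)
    -- Cofinality for the M. Riesz extension: constants lie in the subspace.
    (fun u => ⟨⟨C (ContinuousMap.const G ‖u‖), _, rfl⟩, fun x => by
      have := (abs_le.1 (u.norm_coe_le_norm x)).1
      change 0 ≤ ‖u‖ + u x
      linarith⟩)
  have hMC : ∀ φ : C(G, ℝ), M (φ.comp f) = I φ := fun φ => by
    have h := hM ⟨C φ, φ, rfl⟩
    change M (C φ) = I (e.symm ⟨C φ, φ, rfl⟩) at h
    rw [he] at h
    exact h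
  have hpos' : ∀ u, 0 ≤ u → 0 ≤ M u := fun u hu => hpos u hu
  have h₁ : M 1 = 1 := (hMC 1).trans hI₁
  exact ⟨positiveCLM M hpos' h₁, hpos', hMC⟩

end PositiveFunctional

/-! ### Continuous densities of image functionals. -/

section Density

variable {X : Type*} [TopologicalSpace X] {G : Type*} [TopologicalSpace G]

/-- `c` is the density, with respect to `I`, of the image under `h` of the functional `Λ` weighted
by `u`. -/
def IsDensity (I : C(G, ℝ) →L[ℝ] ℝ) (Λ : C(X, ℝ) →L[ℝ] ℝ) (h : C(X, G)) (u : C(X, ℝ))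
    (c : C(G, ℝ)) : Prop :=
  ∀ φ : C(G, ℝ), Λ (u * φ.comp h) = I (φ * c)

variable {I : C(G, ℝ) →L[ℝ] ℝ} {Λ : C(X, ℝ) →L[ℝ] ℝ} {h : C(X, G)}

/-- Testing with `φ = (c - b)⁺` gives `I (φ * φ) ≤ 0`, so `φ` vanishes by strict positivity. -/
theorem le_of_forall_le (hI : ∀ φ, 0 ≤ φ → φ ≠ 0 → 0 < I φ) {c : C(G, ℝ)} {b : ℝ}
    (hc : ∀ φ : C(G, ℝ), 0 ≤ φ → I (φ * c) ≤ b * I φ) (t : G) : c t ≤ b := by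
  by_contra! ht
  let φ : C(G, ℝ) := (c - ContinuousMap.const G b) ⊔ 0
  have hφ : ∀ s, φ s = max (c s - b) 0 := fun s => rfl
  have h₁ := hc φ le_sup_right
  have h₂ : I (φ * c) - b * I φ = I (φ * φ) := by
    rw [← smul_eq_mul b, ← map_smul, ← map_sub]
    congr 1
    ext s
    simp only [ContinuousMap.sub_apply, ContinuousMap.mul_apply, ContinuousMap.smul_apply, hφ,
      smul_eq_mul]
    rcases le_total (c s - b) 0 with h | h
    · simp [h]
    · rw [max_eq_left h]; ring
  have h₃ : 0 < I (φ * φ) := by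
    refine hI _ (fun s => mul_self_nonneg _) fun h0 => ?_
    have h₄ : 0 < φ t := by rw [hφ]; exact lt_max_of_lt_left (by linarith)
    exact (mul_pos h₄ h₄).ne' (DFunLike.congr_fun h0 t)
  linarith

variable [CompactSpace X] [CompactSpace G]

/-- Positivity bounds the weighted image by `‖u‖ * I`. This yields both uniqueness of densities and
the bound on `T`. -/
theorem IsDensity.norm_le (hI : ∀ φ, 0 ≤ φ → φ ≠ 0 → 0 < I φ) (hΛ : ∀ u, 0 ≤ u → 0 ≤ Λ u)
    (hΛh : ∀ φ : C(G, ℝ), Λ (φ.comp h) = I φ)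
    {u : C(X, ℝ)} {c : C(G, ℝ)} (hu : IsDensity I Λ h u c) : ‖c‖ ≤ ‖u‖ := by
  have key : ∀ φ : C(G, ℝ), 0 ≤ φ → |I (φ * c)| ≤ ‖u‖ * I φ := fun φ hφ => by
    rw [← hu, ← hΛh]
    exact abs_mul_le_of_positive (M := Λ.toLinearMap) hΛ fun x => (abs_of_nonneg (hφ (h x))).le
  rw [ContinuousMap.norm_le _ (norm_nonneg _)]
  intro t
  rw [Real.norm_eq_abs, abs_le]
  constructor
  · refine neg_le.1 (le_of_forall_le hI (c := -c) (fun φ hφ => ?_) t)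
    rw [mul_neg, map_neg]
    exact (neg_le_abs _).trans (key φ hφ)
  · exact le_of_forall_le hI (fun φ hφ => (le_abs_self _).trans (key φ hφ)) t

variable (I Λ h) in
/-- The pairs of a continuous weight and its continuous density. -/
def densitySubmodule : Submodule ℝ (C(X, ℝ) × C(G, ℝ)) where
  carrier := {p | IsDensity I Λ h p.1 p.2}
  add_mem' := fun hu hv φ => by
    simp only [Prod.fst_add, Prod.snd_add, add_mul, mul_add, map_add, hu φ, hv φ]
  zero_mem' := fun φ => by simp
  smul_mem' := fun a p hp φ => by
    simp only [Prod.smul_fst, Prod.smul_snd, smul_mul_assoc, mul_smul_comm, map_smul, hp φ]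

theorem isClosed_densitySubmodule :
    IsClosed (densitySubmodule I Λ h : Set (C(X, ℝ) × C(G, ℝ))) := by
  have : (densitySubmodule I Λ h : Set (C(X, ℝ) × C(G, ℝ))) =
      ⋂ φ : C(G, ℝ), {p | Λ (p.1 * φ.comp h) = I (φ * p.2)} := by
    ext p
    simp [densitySubmodule, IsDensity]
  rw [this]
  exact isClosed_iInter fun φ => isClosed_eq (by fun_prop) (by fun_prop)

/-- If continuous densities exist for a dense set of weights, then they exist for all weights and
depend on them linearly and continuously. -/
theorem exists_density_operator (hI : ∀ φ, 0 ≤ φ → φ ≠ 0 → 0 < I φ)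
    (hΛ : ∀ u, 0 ≤ u → 0 ≤ Λ u) (hΛh : ∀ φ : C(G, ℝ), Λ (φ.comp h) = I φ)
    (hdense : Dense {u : C(X, ℝ) | ∃ c, IsDensity I Λ h u c}) :
    ∃ T : C(X, ℝ) →L[ℝ] C(G, ℝ), ∀ u, IsDensity I Λ h u (T u) := by
  let D := densitySubmodule I Λ h
  have hD : ∀ p : D, ‖p.1.2‖ ≤ ‖p.1.1‖ := fun p => IsDensity.norm_le hI hΛ hΛh p.2
  let F : D →ₗ[ℝ] C(X, ℝ) := LinearMap.fst ℝ _ _ ∘ₗ D.subtype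
  -- The projection from the closed graph to the weights is bounded below, so its range is closed;
  -- being dense, it is everything.
  have hF : ∀ p : D, ‖p‖ ≤ 1 * ‖F p‖ := fun p => by
    rw [one_mul]
    exact max_le le_rfl (hD p)
  have hanti := AddMonoidHomClass.antilipschitz_of_bound F (K := 1) hF
  have hcont : UniformContinuous F := uniformContinuous_fst.comp uniformContinuous_subtype_val
  have : CompleteSpace D := (isClosed_densitySubmodule (I := I) (Λ := Λ) (h := h)).completeSpace_coe
  have hsurj : Function.Surjective F := by
    have hcl := (hanti.isClosed_range hcont)
    have : Dense (Set.range F) := hdense.mono <| by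
      rintro u ⟨c, hc⟩
      exact ⟨⟨(u, c), hc⟩, rfl⟩
    exact Set.range_eq_univ.1 (hcl.closure_eq ▸ this.closure_eq)
  let e := LinearEquiv.ofBijective F ⟨hanti.injective, hsurj⟩
  refine ⟨(LinearMap.snd ℝ _ _ ∘ₗ D.subtype ∘ₗ e.symm.toLinearMap).mkContinuous 1 fun u => ?_,
    fun u => ?_⟩
  · have h₁ := hD (e.symm u)
    have h₂ : (e.symm u).1.1 = u := e.apply_symm_apply u
    rw [h₂] at h₁
    rw [one_mul]
    exact h₁
  · have h₁ := (e.symm u).2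
    have h₂ : (e.symm u).1.1 = u := e.apply_symm_apply u
    change IsDensity I Λ h (e.symm u).1.1 (e.symm u).1.2 at h₁
    rw [h₂] at h₁
    exact h₁

end Density

/-! ### Tensors, product functionals and Fubini. -/

section Tensor

variable {X Y : Type*} [TopologicalSpace X] [TopologicalSpace Y]

/-- The function `(x, y) ↦ v x * w y`. -/
def tensor (v : C(X, ℝ)) (w : C(Y, ℝ)) : C(X × Y, ℝ) :=
  v.comp ContinuousMap.fst * w.comp ContinuousMap.snd

theorem tensor_apply (v : C(X, ℝ)) (w : C(Y, ℝ)) (p : X × Y) : tensor v w p = v p.1 * w p.2 :=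
  rfl

variable [CompactSpace X] [CompactSpace Y] [T2Space X] [T2Space Y]

/-- Stone–Weierstrass: products of tensors are tensors, so their span is already an algebra. -/
theorem dense_span_tensor :
    Dense (Submodule.span ℝ (Set.range fun p : C(X, ℝ) × C(Y, ℝ) => tensor p.1 p.2) :
      Set C(X × Y, ℝ)) := by
  let S : Set C(X × Y, ℝ) := Set.range fun p : C(X, ℝ) × C(Y, ℝ) => tensor p.1 p.2
  have hS : (Submonoid.closure S : Set C(X × Y, ℝ)) ⊆ S := by
    intro u hu
    induction hu using Submonoid.closure_induction with
    | mem u hu => exact hu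
    | one => exact ⟨(1, 1), by ext p; simp [tensor_apply]⟩
    | mul u v _ _ hu hv =>
      obtain ⟨⟨a, b⟩, rfl⟩ := hu
      obtain ⟨⟨c, d⟩, rfl⟩ := hv
      exact ⟨(a * c, b * d), by ext p; simp only [tensor_apply, ContinuousMap.mul_apply]; ring⟩
  have hadj : (Algebra.adjoin ℝ S).SeparatesPoints := by
    intro p q hpq
    have hmem : ∀ v w, tensor v w ∈ Algebra.adjoin ℝ S :=
      fun v w => Algebra.subset_adjoin ⟨(v, w), rfl⟩
    by_cases h₁ : p.1 = q.1
    · have h₂ : p.2 ≠ q.2 := fun h₂ => hpq (Prod.ext h₁ h₂)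
      obtain ⟨w, hw, hne⟩ := separatesPoints_continuous_of_t35Space h₂
      exact ⟨_, ⟨_, hmem 1 ⟨w, hw⟩, rfl⟩, by simpa [tensor_apply] using hne⟩
    · obtain ⟨v, hv, hne⟩ := separatesPoints_continuous_of_t35Space h₁
      exact ⟨_, ⟨_, hmem ⟨v, hv⟩ 1, rfl⟩, by simpa [tensor_apply] using hne⟩
  have htop := ContinuousMap.subalgebra_topologicalClosure_eq_top_of_separatesPoints _ hadj
  have hsub : (Algebra.adjoin ℝ S : Set C(X × Y, ℝ)) ⊆ Submodule.span ℝ S := by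
    have := Algebra.adjoin_eq_span ℝ S
    intro u hu
    have hu' : u ∈ Subalgebra.toSubmodule (Algebra.adjoin ℝ S) := hu
    rw [this] at hu'
    exact Submodule.span_mono hS hu'
  refine Dense.mono hsub fun u => ?_
  rw [← Subalgebra.topologicalClosure_coe, htop]
  trivial

/-- The product of two functionals. -/
noncomputable def productFunctional (M : C(X, ℝ) →L[ℝ] ℝ) (N : C(Y, ℝ) →L[ℝ] ℝ) :
    C(X × Y, ℝ) →L[ℝ] ℝ :=
  M ∘L N.compLeftContinuous ℝ X ∘L
    { toFun := ContinuousMap.curry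
      map_add' := fun _ _ => rfl
      map_smul' := fun _ _ => rfl
      cont := ContinuousMap.continuous_curry }

/-- The function `x ↦ N (u (x, ·))`. -/
noncomputable def sectionIntegral (N : C(Y, ℝ) →L[ℝ] ℝ) (u : C(X × Y, ℝ)) : C(X, ℝ) :=
  ⟨fun x => N (u.curry x), N.continuous.comp u.curry.continuous⟩

theorem productFunctional_apply (M : C(X, ℝ) →L[ℝ] ℝ) (N : C(Y, ℝ) →L[ℝ] ℝ) (u : C(X × Y, ℝ)) :
    productFunctional M N u = M (sectionIntegral N u) := rfl

theorem productFunctional_tensor (M : C(X, ℝ) →L[ℝ] ℝ) (N : C(Y, ℝ) →L[ℝ] ℝ) (v : C(X, ℝ))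
    (w : C(Y, ℝ)) : productFunctional M N (tensor v w) = M v * N w := by
  have : sectionIntegral N (tensor v w) = N w • v := by
    ext x
    have h : (tensor v w).curry x = v x • w := rfl
    change N ((tensor v w).curry x) = N w * v x
    rw [h, map_smul, smul_eq_mul, mul_comm]
  rw [productFunctional_apply, this, map_smul, smul_eq_mul, mul_comm]

theorem productFunctional_nonneg {M : C(X, ℝ) →L[ℝ] ℝ} {N : C(Y, ℝ) →L[ℝ] ℝ}
    (hM : ∀ u, 0 ≤ u → 0 ≤ M u) (hN : ∀ u, 0 ≤ u → 0 ≤ N u) {u : C(X × Y, ℝ)} (hu : 0 ≤ u) :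
    0 ≤ productFunctional M N u :=
  hM _ fun x => hN _ fun y => hu (x, y)

/-- Fubini's theorem for functionals on spaces of continuous functions. -/
theorem productFunctional_swap (M : C(X, ℝ) →L[ℝ] ℝ)
    (N : C(Y, ℝ) →L[ℝ] ℝ) (u : C(X × Y, ℝ)) :
    productFunctional N M (u.comp ContinuousMap.prodSwap) = productFunctional M N u := by
  have hcont : Continuous fun u : C(X × Y, ℝ) =>
      productFunctional N M (u.comp ContinuousMap.prodSwap) :=
    (productFunctional N M).continuous.comp (ContinuousMap.continuous_precomp _)
  refine congr_fun (hcont.ext_on dense_span_tensor (productFunctional M N).continuous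
    fun u hu => ?_) u
  induction hu using Submodule.span_induction with
  | mem u hu =>
    obtain ⟨⟨v, w⟩, rfl⟩ := hu
    have : (tensor v w).comp ContinuousMap.prodSwap = tensor w v := by
      ext p
      exact mul_comm _ _
    simp only [this, productFunctional_tensor, mul_comm]
  | zero => simp
  | add u v _ _ hu hv => simp only [ContinuousMap.add_comp, map_add, hu, hv]
  | smul a u _ hu => simp only [ContinuousMap.smul_comp, map_smul, hu]

end Tensor

/-! ### Approximate orthogonal projection without completing to `L²`. -/

section BestApproximation

variable {Y : Type*} [TopologicalSpace Y]

theorem mul_sq_le_of_positive {N : C(Y, ℝ) →L[ℝ] ℝ} (hN : ∀ u, 0 ≤ u → 0 ≤ N u)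
    (u v : C(Y, ℝ)) : N (u * v) ^ 2 ≤ N (u * u) * N (v * v) := by
  have h : ∀ s : ℝ, 0 ≤ N (v * v) * (s * s) + 2 * N (u * v) * s + N (u * u) := fun s => by
    have h₁ : (u + s • v) * (u + s • v) = (s * s) • (v * v) + (2 * s) • (u * v) + u * u := by
      ext y
      simp only [ContinuousMap.add_apply, ContinuousMap.mul_apply, ContinuousMap.smul_apply,
        smul_eq_mul]
      ring
    have h₂ := hN ((u + s • v) * (u + s • v)) fun y => mul_self_nonneg ((u + s • v) y)
    rw [h₁, map_add, map_add, map_smul, map_smul, smul_eq_mul, smul_eq_mul] at h₂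
    linarith
  have := discrim_le_zero h
  rw [discrim] at this
  linarith

variable {G : Type*} [TopologicalSpace G]

/-- Approximate minimizers of the distance, in the seminorm of a positive functional `N`, from `w`
to the functions that factor through `g`. -/
theorem exists_approx_minimizers {N : C(Y, ℝ) →L[ℝ] ℝ} (hN : ∀ u, 0 ≤ u → 0 ≤ N u)
    {I : C(G, ℝ) →L[ℝ] ℝ} {g : C(Y, G)} (hNg : ∀ φ : C(G, ℝ), N (φ.comp g) = I φ)
    (w : C(Y, ℝ)) :
    ∃ e : ℕ → C(G, ℝ),
      (∀ k j, I ((e k - e j) * (e k - e j)) ≤ 2 * (1 / ((k : ℝ) + 1) + 1 / ((j : ℝ) + 1))) ∧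
      ∀ k φ, N ((w - (e k).comp g) * φ.comp g) ^ 2 ≤ 1 / ((k : ℝ) + 1) * I (φ * φ) := by
  let Q : C(G, ℝ) → ℝ := fun e => N ((w - e.comp g) * (w - e.comp g))
  have hQ : ∀ e, 0 ≤ Q e := fun e => hN _ fun y => mul_self_nonneg _
  have hbdd : BddBelow (Set.range Q) := ⟨0, by rintro _ ⟨e, rfl⟩; exact hQ e⟩
  have hd : ∀ e, (⨅ e, Q e) ≤ Q e := ciInf_le hbdd
  have hex : ∀ k : ℕ, ∃ e, Q e < (⨅ e, Q e) + 1 / ((k : ℝ) + 1) := fun k =>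
    exists_lt_of_ciInf_lt (lt_add_of_pos_right _ (by positivity))
  generalize (⨅ e, Q e) = d at hd hex
  choose e he using hex
  refine ⟨e, fun k j => ?_, fun k φ => ?_⟩
  -- Parallelogram law, with the midpoint of `e k` and `e j` as competitor.
  · have h₁ : (w - (e k).comp g) * (w - (e k).comp g) + (w - (e j).comp g) * (w - (e j).comp g) =
        (2 : ℝ) • ((w - ((1 / 2 : ℝ) • (e k + e j)).comp g) *
          (w - ((1 / 2 : ℝ) • (e k + e j)).comp g)) +
        (1 / 2 : ℝ) • ((e k - e j) * (e k - e j)).comp g := by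
      ext y
      simp only [ContinuousMap.add_apply, ContinuousMap.sub_apply, ContinuousMap.mul_apply,
        ContinuousMap.smul_apply, ContinuousMap.comp_apply, smul_eq_mul]
      ring
    have h₂ : Q (e k) + Q (e j) = 2 * Q ((1 / 2 : ℝ) • (e k + e j)) +
        1 / 2 * I ((e k - e j) * (e k - e j)) := by
      have := congrArg N h₁
      rwa [map_add, map_add, map_smul, map_smul, hNg, smul_eq_mul, smul_eq_mul] at this
    have h₃ := hd ((1 / 2 : ℝ) • (e k + e j))
    have h₄ := he k
    have h₅ := he j
    linarith
  -- Perturbing `e k` by `s • φ` lowers `Q` by at most `1 / (k + 1)`; the discriminant turns this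
  -- into near-orthogonality.
  · have h : ∀ s : ℝ, 0 ≤ I (φ * φ) * (s * s) +
        (-2 * N ((w - (e k).comp g) * φ.comp g)) * s + 1 / ((k : ℝ) + 1) := fun s => by
      have h₁ : (w - (e k + s • φ).comp g) * (w - (e k + s • φ).comp g) =
          (s * s) • (φ * φ).comp g + (-2 * s) • ((w - (e k).comp g) * φ.comp g) +
            (w - (e k).comp g) * (w - (e k).comp g) := by
        ext y
        simp only [ContinuousMap.add_apply, ContinuousMap.sub_apply, ContinuousMap.mul_apply,
          ContinuousMap.smul_apply, ContinuousMap.comp_apply, smul_eq_mul]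
        ring
      have h₂ : Q (e k + s • φ) = s * s * I (φ * φ) +
          -2 * s * N ((w - (e k).comp g) * φ.comp g) + Q (e k) := by
        have := congrArg N h₁
        rwa [map_add, map_add, map_smul, map_smul, hNg, smul_eq_mul, smul_eq_mul] at this
      have h₃ := hd (e k + s • φ)
      have h₄ := he k
      linarith
    have := discrim_le_zero h
    rw [discrim] at this
    linarith

end BestApproximation

/-! ### Convolution and the averaging operator. -/

section Convolution

variable {X Y G : Type*} [TopologicalSpace X] [TopologicalSpace Y]
  [TopologicalSpace G] [AddCommGroup G] [IsTopologicalAddGroup G]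
  {M : C(X, ℝ) →L[ℝ] ℝ} {N : C(Y, ℝ) →L[ℝ] ℝ} {I : C(G, ℝ) →L[ℝ] ℝ} {f : C(X, G)} {g : C(Y, G)}

/-- The function `(x, y) ↦ f x + g y`. -/
def sumMap (f : C(X, G)) (g : C(Y, G)) : C(X × Y, G) :=
  ⟨fun p => f p.1 + g p.2, by fun_prop⟩

/-- The function `s ↦ φ (a + s)`. -/
def translate (φ : C(G, ℝ)) (a : G) : C(G, ℝ) :=
  ⟨fun s => φ (a + s), by fun_prop⟩

/-- The function `s ↦ φ (t - s)`. -/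
def reflect (φ : C(G, ℝ)) (t : G) : C(G, ℝ) :=
  ⟨fun s => φ (t - s), by fun_prop⟩

/-- The convolution of `e` with the image under `f` of the functional `M` weighted by `v`. -/
noncomputable def conv (M : C(X, ℝ) →L[ℝ] ℝ) (f : C(X, G)) (v : C(X, ℝ)) (e : C(G, ℝ)) : C(G, ℝ) :=
  sectionIntegral M ⟨fun p : G × X => v p.2 * e (p.1 - f p.2), by fun_prop⟩

theorem conv_apply (v : C(X, ℝ)) (e : C(G, ℝ)) (t : G) :
    conv M f v e t = M (v * (reflect e t).comp f) := rfl

theorem conv_sub (v : C(X, ℝ)) (e e' : C(G, ℝ)) :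
    conv M f v e - conv M f v e' = conv M f v (e - e') := by
  ext t
  rw [ContinuousMap.sub_apply, conv_apply, conv_apply, conv_apply, ← map_sub, ← mul_sub]
  rfl

/-- Cauchy–Schwarz at each point: convolution turns `L²` convergence into uniform convergence. -/
theorem norm_conv_le [CompactSpace G] (hM : ∀ u, 0 ≤ u → 0 ≤ M u) (hMf : ∀ φ : C(G, ℝ), M (φ.comp f) = I φ)
    (hIr : ∀ φ t, I (reflect φ t) = I φ) (v : C(X, ℝ)) (e : C(G, ℝ)) :
    ‖conv M f v e‖ ≤ √(M (v * v) * I (e * e)) := by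
  rw [ContinuousMap.norm_le _ (Real.sqrt_nonneg _)]
  intro t
  refine Real.abs_le_sqrt ?_
  have h₁ := mul_sq_le_of_positive hM v ((reflect e t).comp f)
  have h₂ : M ((reflect e t).comp f * (reflect e t).comp f) = I (e * e) := by
    rw [← hIr (e * e) t, ← hMf]
    rfl
  rwa [h₂] at h₁

theorem sectionIntegral_tensor_mul (v : C(X, ℝ)) (w : C(Y, ℝ)) (φ : C(G, ℝ)) (x : X) :
    sectionIntegral N (tensor v w * φ.comp (sumMap f g)) x =
      v x * N (w * (translate φ (f x)).comp g) := by
  rw [← smul_eq_mul (v x), ← map_smul]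
  refine congrArg N ?_
  ext y
  exact mul_assoc (v x) (w y) _

variable [CompactSpace X] [T2Space X] [CompactSpace Y] [T2Space Y]

/-- Since the second weight factors through `g`, `N` becomes `I`; translation by `f x` and Fubini do
the rest. -/
theorem isDensity_conv [CompactSpace G] [T2Space G] (hNg : ∀ φ : C(G, ℝ), N (φ.comp g) = I φ)
    (hIt : ∀ φ a, I (translate φ a) = I φ) (v : C(X, ℝ)) (e : C(G, ℝ)) :
    IsDensity I (productFunctional M N) (sumMap f g) (tensor v (e.comp g)) (conv M f v e) := by
  intro φ
  let F : C(G × X, ℝ) := ⟨fun p => φ p.1 * (v p.2 * e (p.1 - f p.2)), by fun_prop⟩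
  have h₁ : φ * conv M f v e = sectionIntegral M F := by
    ext t
    rw [ContinuousMap.mul_apply, conv_apply, ← smul_eq_mul (φ t), ← map_smul]
    rfl
  rw [h₁, ← productFunctional_apply I M, ← productFunctional_swap I M, productFunctional_apply,
    productFunctional_apply]
  refine congrArg M ?_
  ext x
  rw [sectionIntegral_tensor_mul]
  have h₂ : N (e.comp g * (translate φ (f x)).comp g) = I (e * translate φ (f x)) :=
    hNg (e * translate φ (f x))
  rw [h₂, ← smul_eq_mul (v x), ← map_smul]
  change _ = I ((F.comp ContinuousMap.prodSwap).curry x)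
  rw [← hIt ((F.comp ContinuousMap.prodSwap).curry x) (f x)]
  congr 1
  ext s
  change v x * (e s * φ (f x + s)) = φ (f x + s) * (v x * e (f x + s - f x))
  rw [add_sub_cancel_left]
  ring

/-- The projection of `w` onto functions of `g` may exist only in `L²`, but the convolutions with
its approximants `e k` converge uniformly, and their limit is the density. -/
theorem exists_isDensity_tensor [CompactSpace G] [T2Space G] (hM : ∀ u, 0 ≤ u → 0 ≤ M u)
    (hMf : ∀ φ : C(G, ℝ), M (φ.comp f) = I φ) (hN : ∀ u, 0 ≤ u → 0 ≤ N u)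
    (hNg : ∀ φ : C(G, ℝ), N (φ.comp g) = I φ) (hIt : ∀ φ a, I (translate φ a) = I φ)
    (hIr : ∀ φ t, I (reflect φ t) = I φ) (v : C(X, ℝ)) (w : C(Y, ℝ)) :
    ∃ c, IsDensity I (productFunctional M N) (sumMap f g) (tensor v w) c := by
  obtain ⟨e, he, heN⟩ := exists_approx_minimizers hN hNg w
  have hlim : Filter.Tendsto (fun k : ℕ => 1 / ((k : ℝ) + 1)) Filter.atTop (𝓝 0) :=
    tendsto_one_div_add_atTop_nhds_zero_nat
  have hvv : 0 ≤ M (v * v) := hM _ fun x => mul_self_nonneg _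
  have hsqrt : ∀ C : ℝ, Filter.Tendsto (fun k : ℕ => √(C * (1 / ((k : ℝ) + 1)))) Filter.atTop
      (𝓝 0) := fun C => by
    simpa using ((hlim.const_mul C).sqrt)
  have hcau : CauchySeq fun k => conv M f v (e k) := by
    -- The `4` is `2 * (1 + 1)`: both reciprocals in `he` are at most `1 / (k + 1)`.
    refine cauchySeq_of_le_tendsto_0 _ (fun n m k hn hm => ?_) (hsqrt (M (v * v) * 4))
    rw [dist_eq_norm, conv_sub]
    refine (norm_conv_le hM hMf hIr v _).trans (Real.sqrt_le_sqrt ?_)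
    rw [mul_assoc]
    refine mul_le_mul_of_nonneg_left ((he n m).trans ?_) hvv
    have h₁ := Nat.one_div_le_one_div (α := ℝ) hn
    have h₂ := Nat.one_div_le_one_div (α := ℝ) hm
    linarith
  obtain ⟨c, hc⟩ := cauchySeq_tendsto_of_complete hcau
  refine ⟨c, fun φ => ?_⟩
  have h₁ : Filter.Tendsto (fun k => I (φ * conv M f v (e k))) Filter.atTop (𝓝 (I (φ * c))) :=
    (I.continuous.tendsto _).comp (hc.const_mul φ)
  refine tendsto_nhds_unique ?_ h₁
  rw [tendsto_iff_dist_tendsto_zero]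
  refine squeeze_zero (fun _ => dist_nonneg) (fun k => ?_)
    (by simpa using (hsqrt (I (φ * φ))).const_mul (‖v‖ * M 1))
  -- The error pairs `w - e k ∘ g` with translates of `φ`, all with the same `I (φ * φ)`, so `heN`
  -- bounds it uniformly in `x`.
  have h₂ : sectionIntegral N (tensor v w * φ.comp (sumMap f g)) -
      sectionIntegral N (tensor v ((e k).comp g) * φ.comp (sumMap f g)) =
      v * sectionIntegral N (tensor 1 (w - (e k).comp g) * φ.comp (sumMap f g)) := by
    ext x
    simp only [ContinuousMap.sub_apply, ContinuousMap.mul_apply, sectionIntegral_tensor_mul]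
    rw [← mul_sub, ← map_sub, ← sub_mul, ContinuousMap.one_apply, one_mul]
  rw [← isDensity_conv hNg hIt, dist_comm, Real.dist_eq, productFunctional_apply,
    productFunctional_apply, ← map_sub, h₂]
  refine (abs_mul_le_of_positive (M := M.toLinearMap) hM
    (w := √(I (φ * φ) * (1 / ((k : ℝ) + 1))) • 1) fun x => ?_).trans_eq ?_
  · rw [sectionIntegral_tensor_mul, ContinuousMap.one_apply, one_mul, ContinuousMap.smul_apply,
      ContinuousMap.one_apply, smul_eq_mul, mul_one]
    refine Real.abs_le_sqrt ((heN k _).trans_eq ?_)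
    have h₃ : I (translate φ (f x) * translate φ (f x)) = I (φ * φ) := hIt (φ * φ) (f x)
    rw [h₃, mul_comm]
  · change ‖v‖ * M (_ • 1) = _
    rw [map_smul, smul_eq_mul, mul_assoc, mul_comm (M 1), one_div]

theorem productFunctional_comp_sumMap (hM₁ : M 1 = 1) (hNg : ∀ φ : C(G, ℝ), N (φ.comp g) = I φ)
    (hIt : ∀ φ a, I (translate φ a) = I φ) (φ : C(G, ℝ)) :
    productFunctional M N (φ.comp (sumMap f g)) = I φ := by
  have h : sectionIntegral N (φ.comp (sumMap f g)) = I φ • 1 := by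
    ext x
    change N ((translate φ (f x)).comp g) = I φ * 1
    rw [hNg, hIt, mul_one]
  rw [productFunctional_apply, h, map_smul, hM₁, smul_eq_mul, mul_one]

/-- Two continuous surjections onto a compact group induce a bounded operator that is a left inverse
of the composition with their sum. -/
theorem exists_leftInverse_comp_sumMap [CompactSpace G] [T2Space G]
    (hI : ∀ φ, 0 ≤ φ → φ ≠ 0 → 0 < I φ) (hI₁ : I 1 = 1)
    (hIt : ∀ φ a, I (translate φ a) = I φ) (hIr : ∀ φ t, I (reflect φ t) = I φ)
    (hf : Function.Surjective f) (hg : Function.Surjective g) :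
    ∃ T : C(X × Y, ℝ) →L[ℝ] C(G, ℝ), ∀ ψ : C(G, ℝ), T (ψ.comp (sumMap f g)) = ψ := by
  have hI₀ : ∀ φ, 0 ≤ φ → 0 ≤ I φ := fun φ hφ => by
    rcases eq_or_ne φ 0 with rfl | h
    · simp
    · exact (hI φ hφ h).le
  obtain ⟨M, hM, hMf⟩ := exists_positive_lift hI₀ hI₁ f hf
  obtain ⟨N, hN, hNg⟩ := exists_positive_lift hI₀ hI₁ g hg
  have hM₁ : M 1 = 1 := (hMf 1).trans hI₁
  have hΛ : ∀ u, 0 ≤ u → 0 ≤ productFunctional M N u := fun u => productFunctional_nonneg hM hN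
  have hΛh := productFunctional_comp_sumMap (f := f) hM₁ hNg hIt
  obtain ⟨T, hT⟩ := exists_density_operator hI hΛ hΛh <| by
    refine dense_span_tensor.mono fun u hu => ?_
    have hle : Submodule.span ℝ (Set.range fun p : C(X, ℝ) × C(Y, ℝ) => tensor p.1 p.2) ≤
        (densitySubmodule I (productFunctional M N) (sumMap f g)).map
          (LinearMap.fst ℝ C(X × Y, ℝ) C(G, ℝ)) := by
      rw [Submodule.span_le]
      rintro _ ⟨⟨v, w⟩, rfl⟩
      obtain ⟨c, hc⟩ := exists_isDensity_tensor hM hMf hN hNg hIt hIr v w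
      exact ⟨(_, c), hc, rfl⟩
    obtain ⟨⟨u, c⟩, hc, rfl⟩ := hle hu
    exact ⟨c, hc⟩
  refine ⟨T, fun ψ => ?_⟩
  -- Both `T (ψ ∘ h)` and `ψ` are densities for the weight `ψ ∘ h`, so their difference is a density
  -- for `0`.
  have h₁ : IsDensity I (productFunctional M N) (sumMap f g) 0
      (T (ψ.comp (sumMap f g)) - ψ) := fun φ => by
    rw [mul_sub, map_sub, ← hT, zero_mul, map_zero, ← hΛh, mul_comm, sub_eq_zero.2]
    rfl
  have h₂ := h₁.norm_le hI hΛ hΛh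
  rw [norm_zero] at h₂
  exact sub_eq_zero.1 (norm_le_zero_iff.1 h₂)

end Convolution

/-! ### The circle and its fold onto the interval. -/

/-- Integration over the circle with respect to the normalized Haar measure. -/
noncomputable def circleIntegral : C(UnitAddCircle, ℝ) →L[ℝ] ℝ :=
  positiveCLM
    { toFun := fun φ => ∫ t, φ t ∂AddCircle.haarAddCircle
      map_add' := fun φ ψ => integral_add
        (φ.continuous.integrable_of_hasCompactSupport (HasCompactSupport.of_compactSpace φ))
        (ψ.continuous.integrable_of_hasCompactSupport (HasCompactSupport.of_compactSpace ψ))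
      map_smul' := fun c φ => integral_const_mul c φ }
    (fun _ hu => integral_nonneg hu) (by simp)

theorem circleIntegral_apply (φ : C(UnitAddCircle, ℝ)) :
    circleIntegral φ = ∫ t, φ t ∂AddCircle.haarAddCircle := rfl

theorem circleIntegral_pos (φ : C(UnitAddCircle, ℝ)) (h : 0 ≤ φ) (h' : φ ≠ 0) :
    0 < circleIntegral φ := by
  obtain ⟨t, ht⟩ := DFunLike.ne_iff.1 h'
  exact φ.continuous.integral_pos_of_hasCompactSupport_nonneg_nonzero
    (HasCompactSupport.of_compactSpace _) h ht

theorem circleIntegral_translate (φ : C(UnitAddCircle, ℝ)) (a : UnitAddCircle) :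
    circleIntegral (translate φ a) = circleIntegral φ :=
  integral_add_left_eq_self (fun t => φ t) a

theorem circleIntegral_reflect (φ : C(UnitAddCircle, ℝ)) (a : UnitAddCircle) :
    circleIntegral (reflect φ a) = circleIntegral φ :=
  integral_sub_left_eq_self (fun t => φ t) _ a

/-- The fold `θ ↦ 2‖θ‖` of the circle onto the unit interval. -/
noncomputable def fold : C(UnitAddCircle, unitInterval) :=
  ⟨fun θ => ⟨2 * ‖θ‖, by positivity, by
    have := AddCircle.norm_le_half_period (1 : ℝ) (x := θ) one_ne_zero
    rw [abs_one] at this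
    linarith⟩, by fun_prop⟩

/-- The section `t ↦ t / 2` of the fold. -/
noncomputable def unfold : C(unitInterval, UnitAddCircle) :=
  ⟨fun t => ((t / 2 : ℝ) : UnitAddCircle), by
    exact (AddCircle.continuous_mk' 1).comp (by fun_prop)⟩

theorem fold_comp_unfold : fold.comp unfold = ContinuousMap.id unitInterval := by
  ext t
  change 2 * ‖((t / 2 : ℝ) : UnitAddCircle)‖ = t
  have h₀ := t.2.1
  have h₁ := t.2.2
  rw [(AddCircle.norm_coe_eq_abs_iff (1 : ℝ) one_ne_zero).2, abs_of_nonneg (by linarith)]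
  · ring
  · rw [abs_of_nonneg (by linarith), abs_one]
    linarith

/-- Binary expansion carries the Cantor space onto `[0,1]`, whose endpoints are then glued. -/
theorem exists_continuous_surjective_circle {A : Type*} [BooleanAlgebra A] (hA : ¬ IsAtomic A) :
    ∃ f : C(StonePoint A, UnitAddCircle), Function.Surjective f := by
  obtain ⟨b, hb⟩ := StonePoint.exists_continuous_surjective_nat_bool hA
  have hq : Function.Surjective fun t : unitInterval => ((t : ℝ) : UnitAddCircle) := fun θ => by
    obtain ⟨t, ht, rfl⟩ := AddCircle.coe_image_Icc_eq (1 : ℝ) 0 ▸ Set.mem_univ θ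
    exact ⟨⟨t, ht.1, by simpa using ht.2⟩, rfl⟩
  refine ⟨⟨fun x => ((Real.fromBinary (b x) : ℝ) : UnitAddCircle), ?_⟩,
    hq.comp (Real.fromBinary_surjective.comp hb)⟩
  exact (AddCircle.continuous_mk' 1).comp
    (continuous_subtype_val.comp (Real.fromBinary_continuous.comp b.continuous))

/-- The composition with a continuous map as a bounded operator. -/
noncomputable def compCLM {X Y : Type*} [TopologicalSpace X] [TopologicalSpace Y] (h : C(X, Y)) :
    C(Y, ℝ) →L[ℝ] C(X, ℝ) where
  toFun := fun u => u.comp h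
  map_add' := fun _ _ => rfl
  map_smul' := fun _ _ => rfl
  cont := ContinuousMap.continuous_precomp h

end AveragingOperator

/-! ### Assembling the projection on `C(K)`. -/

theorem containsComplementedCopy_of_leftInverse {X Y : Type*} [NormedAddCommGroup X]
    [NormedSpace ℝ X] [NormedAddCommGroup Y] [NormedSpace ℝ Y] (E : Y →L[ℝ] X) (P : X →L[ℝ] Y)
    (h : Function.LeftInverse P E) : ContainsComplementedCopy X Y :=
  ⟨E.range, E.closedComplemented_range_of_leftInverse P h,
    ⟨{ LinearEquiv.ofLeftInverse (f := E.toLinearMap) h with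
      continuous_toFun := E.continuous.subtype_mk _
      continuous_invFun := P.continuous.comp continuous_subtype_val }⟩⟩

open AveragingOperator in
theorem corollary4p2 {K : Type*} [TopologicalSpace K] [CompactSpace K] [T2Space K]
    (hK : TopologicalSpace.IsTopologicalBasis {s : Set K | IsClopen s})
    {A B : Type*} [BooleanAlgebra A] [BooleanAlgebra B]
    (hA : ¬ IsAtomic A) (hB : ¬ IsAtomic B)
    (φ : BoundedLatticeHom (TopologicalSpace.Clopens K) (freeProduct A B))
    (hφ : Function.Surjective φ) :
    ContainsComplementedCopy C(K, ℝ) C(unitInterval, ℝ) := by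
  obtain ⟨j, hj⟩ := StonePoint.exists_isClosedEmbedding hK φ hφ
  obtain ⟨f, hf⟩ := exists_continuous_surjective_circle hA
  obtain ⟨g, hg⟩ := exists_continuous_surjective_circle hB
  obtain ⟨T, hT⟩ := exists_leftInverse_comp_sumMap (I := circleIntegral) circleIntegral_pos
    (by simp [circleIntegral_apply]) circleIntegral_translate circleIntegral_reflect hf hg
  -- Folding comes first because Tietze extension applies to maps into the interval, not to maps
  -- into the circle.
  obtain ⟨H, hH⟩ := ContinuousMap.exists_extension hj (fold.comp (sumMap f g))
  refine containsComplementedCopy_of_leftInverse (compCLM H)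
    (compCLM unfold ∘L T ∘L compCLM ⟨j, hj.continuous⟩) fun u => ?_
  change (T ((u.comp H).comp ⟨j, hj.continuous⟩)).comp unfold = u
  rw [ContinuousMap.comp_assoc, hH, ← ContinuousMap.comp_assoc, hT, ContinuousMap.comp_assoc,
    fold_comp_unfold, ContinuousMap.comp_id]
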